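/- Let $\mathcal X,\mathcal Y$ be finite alphabets, $m=|\mathcal Y|$, and let $W=(W(y|x))_{x\in\mathcal X,y\in\mathcal Y}$ be a row-stochastic matrix with strictly positive entries. The noisy permutation channel of blocklength $n$ sends $x^n\in\mathcal X^n$ through the memoryless channel $W$, giving $Z^n$ with law $\prod_{i=1}^n W(z_i|x_i)$, and then outputs $Y^n$ with $Y_{\sigma(i)}=Z_i$ for $1\le i\le n$, where $\sigma$ is an independent uniformly random permutation of $\{1,\dots,n\}$. A code consists of a finite nonempty message set $\mathcal M$, an encoder $f:\mathcal M\to\mathcal X^n$ and a decoder $g:\mathcal Y^n\to\mathcal M\cup\{\mathtt e\}$; its average error probability is $P_e=\mathbb P[g(Y^n)\neq U]$, where $U$ is uniform on $\mathcal M$ and $X^n=f(U)$. For $\epsilon\in(0,1)$ let $M^\star(n,\epsilon)$ be the largest $|\mathcal M|$ over all codes of blocklength $n$ with $P_e\le\epsilon$. Let $\mathcal P_W=\operatorname{conv}\{W(\cdot|x):x\in\mathcal X\}\subseteq\mathbb R^m$, let $A=\operatorname{aff}(\mathcal P_W)$, let $d=\dim A$ be the affine dimension of $\mathcal P_W$,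 and let $\mathcal R_W=A\cap\Delta_{m-1}$, where $\Delta_{m-1}$ is the probability simplex in $\mathbb R^m$. Define $$\lambda_W^\star=\frac{\operatorname{vol}_d(\mathcal P_W)}{\inf\{\operatorname{vol}_d(S): S \text{ a } d\text{-simplex},\ \mathcal R_W\subseteq S\subseteq A\}},$$ where $\operatorname{vol}_d$ is the $d$-dimensional Euclidean volume on $A$. Theorem. Suppose $d\ge 1$. For every $a>0$ and every $\epsilon\in(0,1)$ there is a constant $C_{W,\epsilon,a}<\infty$, depending only on $W$, $\epsilon$ and $a$, such that for all sufficiently large $n$ $$\log M^\star(n,\epsilon)\le d\log\left(\frac{\sqrt n}{a}\right)+\log\lambda_W^\star+C_{W,\epsilon,a},$$ where all logarithms are to base two. -/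

import Mathlib

open MeasureTheory

noncomputable section

namespace NoisyPerm

/-! ### The noisy permutation channel and its codes -/

section Channel

variable {X Y : Type*} [Fintype Y] [DecidableEq Y]

/-- A row-stochastic matrix `W`, where `W x y` is the probability `W(y|x)`. -/
structure IsChannel (W : Matrix X Y ℝ) : Prop where
  nonneg : ∀ x y, 0 ≤ W x y
  row_sum : ∀ x, ∑ y, W x y = 1

/-- The memoryless law of the noisy codeword `z` given the input codeword `x`. -/
def dmcLaw (W : Matrix X Y ℝ) {n : ℕ} (x : Fin n → X) (z : Fin n → Y) : ℝ :=
  ∏ i, W (x i) (z i)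

/-- The uniformly random permutation block: the probability that `y (σ i) = z i` for all `i`,
where `σ` is uniform on the symmetric group. -/
def permBlock {n : ℕ} (z y : Fin n → Y) : ℝ :=
  (Finset.card {σ : Equiv.Perm (Fin n) | ∀ i, y (σ i) = z i} : ℝ) / (n.factorial : ℝ)

/-- The transition kernel of the noisy permutation channel: the memoryless channel followed by the
random permutation block. -/
def permKernel (W : Matrix X Y ℝ) {n : ℕ} (x : Fin n → X) (y : Fin n → Y) : ℝ :=
  ∑ z : Fin n → Y, dmcLaw W x z * permBlock z y

/-- A code of blocklength `n` with `M` messages; the value `none` of the decoder is the error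
symbol. -/
structure Code (X Y : Type*) (n M : ℕ) where
  enc : Fin M → (Fin n → X)
  dec : (Fin n → Y) → Option (Fin M)

/-- The average error probability, for a uniformly distributed message. -/
def avgError (W : Matrix X Y ℝ) {n M : ℕ} (c : Code X Y n M) : ℝ :=
  (∑ u : Fin M, ∑ y : Fin n → Y, if c.dec y ≠ some u then permKernel W (c.enc u) y else 0) / M

/-- The sizes of the (nonempty) message sets of codes of blocklength `n` whose average error
probability is at most `ε`. -/
def achievableSizes (W : Matrix X Y ℝ) (n : ℕ) (ε : ℝ) : Set ℕ :=
  {M | 1 ≤ M ∧ ∃ c : Code X Y n M, avgError W c ≤ ε}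

/-- The maximal code size `M⋆(n, ε)`; see `isGreatest_Mstar`. -/
def Mstar (W : Matrix X Y ℝ) (n : ℕ) (ε : ℝ) : ℕ :=
  sSup (achievableSizes W n ε)

end Channel

/-! ### The geometry of the reachable output distributions -/

section Geometry

variable {X Y : Type*} [Fintype Y]

/-- The output distribution `W(·|x)` as a point of Euclidean space. -/
def row (W : Matrix X Y ℝ) (x : X) : EuclideanSpace ℝ Y := WithLp.toLp 2 (W x)

/-- The reachable output polytope: the convex hull of the rows of `W`. -/
def polytope (W : Matrix X Y ℝ) : Set (EuclideanSpace ℝ Y) :=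
  convexHull ℝ (Set.range (row W))

/-- The affine dimension of the reachable output polytope. -/
def dimP (W : Matrix X Y ℝ) : ℕ :=
  Module.finrank ℝ (affineSpan ℝ (polytope W)).direction

/-- The probability simplex over the output alphabet. -/
def outputSimplex (Y : Type*) [Fintype Y] : Set (EuclideanSpace ℝ Y) :=
  {q | (∀ y, 0 ≤ q y) ∧ ∑ y, q y = 1}

/-- The part of the output simplex in the affine hull of the reachable output polytope. -/
def refRegion (W : Matrix X Y ℝ) : Set (EuclideanSpace ℝ Y) :=
  (affineSpan ℝ (polytope W) : Set (EuclideanSpace ℝ Y)) ∩ outputSimplex Y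

/-- The infimum of the `d`-dimensional Euclidean volumes of the `d`-simplices `S` that contain
`refRegion W` and lie in the affine hull of `polytope W`, where `d = dimP W`. The measure `μHE[d]`
is the `d`-dimensional Hausdorff measure normalized so as to agree with the Lebesgue measure. -/
def minSimplexVol (W : Matrix X Y ℝ) : ENNReal :=
  ⨅ (S : Affine.Simplex ℝ (EuclideanSpace ℝ Y) (dimP W))
    (_ : refRegion W ⊆ convexHull ℝ (Set.range S.points))
    (_ : convexHull ℝ (Set.range S.points) ⊆ affineSpan ℝ (polytope W)),
    μHE[dimP W] (convexHull ℝ (Set.range S.points))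

/-- The relative volume ratio `λ_W⋆`; it is positive by `lambdaStar_pos`. -/
def lambdaStar (W : Matrix X Y ℝ) : ℝ :=
  (μHE[dimP W] (polytope W) / minSimplexVol W).toReal

end Geometry

/-! ### The maximum and the logarithm of the volume ratio are well defined -/

section WellDefined

variable {X Y : Type*} [Fintype Y] [DecidableEq Y]

theorem permBlock_nonneg {Y : Type*} [DecidableEq Y] {n : ℕ} (z y : Fin n → Y) : 0 ≤ permBlock z y := by
  unfold permBlock; positivity

theorem sum_permBlock {n : ℕ} (z : Fin n → Y) : ∑ y, permBlock z y = 1 := by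
  unfold permBlock
  rw [← Finset.sum_div, div_eq_one_iff_eq (by positivity)]
  have h : ∀ y : Fin n → Y,
      (Finset.card {σ : Equiv.Perm (Fin n) | ∀ i, y (σ i) = z i} : ℝ) =
        ∑ σ : Equiv.Perm (Fin n), if y = z ∘ σ.symm then 1 else 0 := by
    intro y
    rw [Finset.sum_boole]
    congr 2
    ext σ
    simp only [Finset.mem_filter, Finset.mem_univ, true_and]
    constructor
    · intro h
      funext j
      simpa using h (σ.symm j)
    · rintro rfl i
      simp
  simp_rw [h]
  rw [Finset.sum_comm]
  simp [Fintype.card_perm]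

theorem permKernel_nonneg {W : Matrix X Y ℝ} (hW : IsChannel W) {n : ℕ} (x : Fin n → X)
    (y : Fin n → Y) : 0 ≤ permKernel W x y :=
  Finset.sum_nonneg fun _ _ =>
    mul_nonneg (Finset.prod_nonneg fun _ _ => hW.nonneg _ _) (permBlock_nonneg _ _)

theorem sum_permKernel {W : Matrix X Y ℝ} (hW : IsChannel W) {n : ℕ} (x : Fin n → X) :
    ∑ y, permKernel W x y = 1 := by
  unfold permKernel
  rw [Finset.sum_comm]
  simp_rw [← Finset.mul_sum, sum_permBlock, mul_one, dmcLaw]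
  rw [← Fintype.prod_sum fun i y => W (x i) y]
  simp [hW.row_sum]

theorem permKernel_le_one {W : Matrix X Y ℝ} (hW : IsChannel W) {n : ℕ} (x : Fin n → X)
    (y : Fin n → Y) : permKernel W x y ≤ 1 := by
  rw [← sum_permKernel hW x]
  exact Finset.single_le_sum (fun y _ => permKernel_nonneg hW x y) (Finset.mem_univ y)

theorem bddAbove_achievableSizes {W : Matrix X Y ℝ} (hW : IsChannel W) (n : ℕ) {ε : ℝ}
    (hε : ε < 1) : BddAbove (achievableSizes W n ε) := by
  refine ⟨⌈(Fintype.card (Fin n → Y) : ℝ) / (1 - ε)⌉₊, ?_⟩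
  rintro M ⟨hM, c, hc⟩
  have hM' : (0 : ℝ) < M := by exact_mod_cast hM
  rw [avgError, div_le_iff₀ hM'] at hc
  have h1 : ∑ u : Fin M, ∑ y : Fin n → Y,
      (if c.dec y ≠ some u then permKernel W (c.enc u) y else 0)
      + ∑ u : Fin M, ∑ y : Fin n → Y,
      (if c.dec y = some u then permKernel W (c.enc u) y else 0) = M := by
    rw [← Finset.sum_add_distrib]
    have : ∀ u : Fin M, ∑ y : Fin n → Y,
        (if c.dec y ≠ some u then permKernel W (c.enc u) y else 0)
        + ∑ y : Fin n → Y,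
        (if c.dec y = some u then permKernel W (c.enc u) y else 0) = 1 := by
      intro u
      rw [← Finset.sum_add_distrib, ← sum_permKernel hW (c.enc u)]
      refine Finset.sum_congr rfl fun y _ => ?_
      by_cases h : c.dec y = some u <;> simp [h]
    rw [Finset.sum_congr rfl fun u _ => this u]
    simp
  have h2 : ∑ u : Fin M, ∑ y : Fin n → Y,
      (if c.dec y = some u then permKernel W (c.enc u) y else 0)
      ≤ Fintype.card (Fin n → Y) := by
    rw [Finset.sum_comm]
    have : ∀ y : Fin n → Y, ∑ u : Fin M,
        (if c.dec y = some u then permKernel W (c.enc u) y else 0) ≤ 1 := by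
      intro y
      cases hd : c.dec y with
      | none => simp
      | some v =>
        simp only [Option.some.injEq, Finset.sum_ite_eq, Finset.mem_univ, if_true]
        exact permKernel_le_one hW _ _
    calc _ ≤ ∑ _y : Fin n → Y, (1 : ℝ) := Finset.sum_le_sum fun y _ => this y
      _ = _ := by simp
  have h3 : (M : ℝ) ≤ (Fintype.card (Fin n → Y) : ℝ) / (1 - ε) := by
    rw [le_div_iff₀ (by linarith)]
    linarith
  exact_mod_cast h3.trans (Nat.le_ceil _)

theorem one_mem_achievableSizes [Nonempty X] (W : Matrix X Y ℝ) (n : ℕ) {ε : ℝ} (hε : 0 ≤ ε) :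
    1 ∈ achievableSizes W n ε := by
  obtain ⟨x⟩ := ‹Nonempty X›
  refine ⟨le_rfl, ⟨fun _ _ => x, fun _ => some 0⟩, ?_⟩
  simpa [avgError] using hε

theorem isGreatest_Mstar [Nonempty X] {W : Matrix X Y ℝ} (hW : IsChannel W) (n : ℕ) {ε : ℝ}
    (h0 : 0 ≤ ε) (h1 : ε < 1) : IsGreatest (achievableSizes W n ε) (Mstar W n ε) :=
  ⟨Nat.sSup_mem ⟨1, one_mem_achievableSizes W n h0⟩ (bddAbove_achievableSizes hW n h1),
    fun _ h => le_csSup (bddAbove_achievableSizes hW n h1) h⟩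

end WellDefined

section Volume

variable {X Y : Type*} [Fintype Y]

theorem polytope_subset_refRegion {W : Matrix X Y ℝ} (hW : IsChannel W) :
    polytope W ⊆ refRegion W := by
  refine Set.subset_inter (subset_affineSpan ℝ _) ?_
  refine convexHull_min ?_ ?_
  · rintro _ ⟨x, rfl⟩
    exact ⟨fun y => hW.nonneg x y, hW.row_sum x⟩
  · intro p hp q hq s t hs ht hst
    refine ⟨fun y => ?_, ?_⟩
    · have := mul_nonneg hs (hp.1 y)
      have := mul_nonneg ht (hq.1 y)
      simp only [PiLp.add_apply, PiLp.smul_apply, smul_eq_mul]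
      linarith
    · simp only [PiLp.add_apply, PiLp.smul_apply, smul_eq_mul, Finset.sum_add_distrib,
        ← Finset.mul_sum, hp.2, hq.2]
      linarith

theorem isBounded_outputSimplex : Bornology.IsBounded (outputSimplex Y) := by
  rw [isBounded_iff_forall_norm_le]
  refine ⟨1, fun q hq => ?_⟩
  rw [EuclideanSpace.norm_eq, Real.sqrt_le_iff, one_pow]
  refine ⟨zero_le_one, ?_⟩
  rw [← hq.2]
  refine Finset.sum_le_sum fun y _ => ?_
  have h1 : q y ≤ 1 := hq.2 ▸ Finset.single_le_sum (fun y _ => hq.1 y) (Finset.mem_univ y)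
  rw [Real.norm_eq_abs, sq_abs]
  nlinarith [hq.1 y]

open scoped Pointwise in
/-- A bounded subset of a finite-dimensional space is contained in a simplex. -/
theorem exists_simplex_of_isBounded {V : Type*} [NormedAddCommGroup V] [NormedSpace ℝ V]
    [FiniteDimensional ℝ V] {s : Set V} (hs : Bornology.IsBounded s) :
    ∃ S : Affine.Simplex ℝ V (Module.finrank ℝ V), s ⊆ convexHull ℝ (Set.range S.points) := by
  obtain ⟨b, hb, -⟩ := exists_mem_interior_convexHull_affineBasis (Filter.univ_mem : _ ∈ nhds (0 : V))
  obtain ⟨r, hr, hball⟩ := Metric.mem_nhds_iff.1 (mem_interior_iff_mem_nhds.1 hb)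
  obtain ⟨R, hR0, hR⟩ := hs.exists_pos_norm_le
  set c : ℝ := 2 * R / r
  have hc : 0 < c := by positivity
  have hind : AffineIndependent ℝ (fun i => c • b i) := by
    have := b.ind.map' (LinearMap.toAffineMap (c • LinearMap.id : V →ₗ[ℝ] V))
      (fun x y h => by simpa [hc.ne'] using h)
    exact this
  refine ⟨⟨fun i => c • b i, hind⟩, fun x hx => ?_⟩
  have h1 : Set.range (fun i => c • b i) = c • Set.range b := by
    ext; simp [Set.mem_smul_set]
  change x ∈ convexHull ℝ (Set.range (fun i => c • b i))
  rw [h1, convexHull_smul, Set.mem_smul_set_iff_inv_smul_mem₀ hc.ne']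
  apply hball
  rw [mem_ball_zero_iff, norm_smul, norm_inv, Real.norm_of_nonneg hc.le]
  calc c⁻¹ * ‖x‖ ≤ c⁻¹ * R := by gcongr; exact hR x hx
    _ = r / 2 := by simp only [c]; field_simp
    _ < r := by linarith

theorem lambdaStar_pos [Nonempty X] {W : Matrix X Y ℝ} (hW : IsChannel W) :
    0 < lambdaStar W := by
  set A := affineSpan ℝ (polytope W) with hA
  obtain ⟨x0⟩ := ‹Nonempty X›
  set p : EuclideanSpace ℝ Y := row W x0
  have hp : p ∈ polytope W := subset_convexHull ℝ _ ⟨x0, rfl⟩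
  have hpA : p ∈ A := subset_affineSpan ℝ _ hp
  let f : A.direction →ᵃ[ℝ] EuclideanSpace ℝ Y :=
    A.direction.subtype.toAffineMap + AffineMap.const ℝ A.direction p
  have hfv : ∀ v, f v = (v : EuclideanSpace ℝ Y) + p := fun v => rfl
  have hf : Isometry f := by
    refine Isometry.of_dist_eq fun v w => ?_
    rw [hfv, hfv, dist_add_right, Subtype.dist_eq]
  have hrange : Set.range f = A := by
    ext q
    constructor
    · rintro ⟨v, rfl⟩
      exact AffineSubspace.vadd_mem_of_mem_direction v.2 hpA
    · intro hq
      exact ⟨⟨q - p, AffineSubspace.vsub_mem_direction hq hpA⟩, by simp [hfv]⟩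
  have hvol : ∀ s : Set (EuclideanSpace ℝ Y), s ⊆ A → μHE[dimP W] s = volume (f ⁻¹' s) := by
    intro s hs
    rw [← InnerProductSpace.euclideanHausdorffMeasure_eq_volume]
    have := hf.euclideanHausdorffMeasure_preimage (d := dimP W) s
    rw [hrange, Set.inter_eq_left.2 hs] at this
    exact this.symm
  -- the polytope has positive volume
  have hPA : polytope W ⊆ A := subset_affineSpan ℝ _
  have hspan : affineSpan ℝ (f ⁻¹' polytope W) = ⊤ := by
    have hmap : (affineSpan ℝ (f ⁻¹' polytope W)).map f = A := by
      rw [AffineSubspace.map_span, Set.image_preimage_eq_of_subset (by rw [hrange]; exact hPA)]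
    refine eq_top_iff.2 fun v _ => ?_
    have hv : f v ∈ (affineSpan ℝ (f ⁻¹' polytope W)).map f := by
      rw [hmap, ← SetLike.mem_coe, ← hrange]
      exact ⟨v, rfl⟩
    obtain ⟨w, hw, hwv⟩ := hv
    exact hf.injective hwv ▸ hw
  have hconv : Convex ℝ (f ⁻¹' polytope W) := (convex_convexHull ℝ _).affine_preimage f
  have hPpos : 0 < μHE[dimP W] (polytope W) := by
    rw [hvol _ hPA]
    exact Measure.measure_pos_of_nonempty_interior _
      (hconv.interior_nonempty_iff_affineSpan_eq_top.2 hspan)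
  -- some simplex of finite volume contains the reference region
  have hfin : minSimplexVol W < ⊤ := by
    have hb : Bornology.IsBounded (f ⁻¹' refRegion W) :=
      hf.antilipschitz.isBounded_preimage (isBounded_outputSimplex.subset Set.inter_subset_right)
    obtain ⟨S, hS⟩ := exists_simplex_of_isBounded hb
    have himg : convexHull ℝ (Set.range (S.map f hf.injective).points)
        = f '' convexHull ℝ (Set.range S.points) := by
      rw [AffineMap.image_convexHull, Affine.Simplex.map_points, Set.range_comp]
    have hsub : convexHull ℝ (Set.range (S.map f hf.injective).points) ⊆ A := by
      rw [himg, ← hrange]; exact Set.image_subset_range _ _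
    have hsup : refRegion W ⊆ convexHull ℝ (Set.range (S.map f hf.injective).points) := by
      rw [himg]
      intro q hq
      obtain ⟨v, rfl⟩ : q ∈ Set.range f := by rw [hrange]; exact hq.1
      exact ⟨v, hS hq, rfl⟩
    have hle : minSimplexVol W ≤
        μHE[dimP W] (convexHull ℝ (Set.range (S.map f hf.injective).points)) :=
      (iInf_le _ (S.map f hf.injective)).trans ((iInf_le _ hsup).trans (iInf_le _ hsub))
    refine hle.trans_lt ?_
    rw [hvol _ hsub, himg, Set.preimage_image_eq _ hf.injective]
    exact ((Set.finite_range S.points).isCompact_convexHull ℝ).measure_lt_top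
  have hle : μHE[dimP W] (polytope W) ≤ minSimplexVol W :=
    le_iInf fun S => le_iInf fun h => le_iInf fun _ =>
      measure_mono ((polytope_subset_refRegion hW).trans h)
  refine ENNReal.toReal_pos (ENNReal.div_pos hPpos.ne' hfin.ne).ne' ?_
  exact (ENNReal.div_lt_top (hle.trans_lt hfin).ne (hPpos.trans_le hle).ne').ne

end Volume

end NoisyPerm

end

noncomputable section

namespace NoisyPerm

/-! ### The standard complex Gaussian measure -/

section Gaussian

open Complex ComplexConjugate

/-- The standard complex Gaussian measure on `ℂ`, with density `exp (-‖w‖²) / π`. -/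
def complexGaussian : Measure ℂ :=
  volume.withDensity fun w => ENNReal.ofReal (Real.exp (-‖w‖ ^ 2) / Real.pi)

theorem integral_norm_pow_mul_exp (k : ℕ) :
    ∫ w : ℂ, ‖w‖ ^ k * Real.exp (-‖w‖ ^ 2) = Real.pi * Real.Gamma ((k + 2) / 2) := by
  have h := Complex.integral_rpow_mul_exp_neg_rpow (p := 2) (q := k) one_le_two
    (by have : (0 : ℝ) ≤ k := k.cast_nonneg
        linarith)
  rw [mul_div_cancel_left₀ _ (two_ne_zero' ℝ)] at h
  rw [← h]
  refine integral_congr_ae (.of_forall fun w => ?_)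
  simp [Real.rpow_natCast]

theorem integrable_norm_pow_mul_exp (k : ℕ) :
    Integrable fun w : ℂ => ‖w‖ ^ k * Real.exp (-‖w‖ ^ 2) := by
  by_contra h
  have h1 := integral_undef h
  rw [integral_norm_pow_mul_exp] at h1
  have : 0 < Real.pi * Real.Gamma ((k + 2) / 2) :=
    mul_pos Real.pi_pos (Real.Gamma_pos_of_pos (by positivity))
  exact this.ne' h1

theorem measurable_gaussianDensity :
    Measurable fun w : ℂ => ENNReal.ofReal (Real.exp (-‖w‖ ^ 2) / Real.pi) := by
  fun_prop

theorem toReal_gaussianDensity (w : ℂ) :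
    (ENNReal.ofReal (Real.exp (-‖w‖ ^ 2) / Real.pi)).toReal = Real.exp (-‖w‖ ^ 2) / Real.pi :=
  ENNReal.toReal_ofReal (by positivity)

theorem integrable_complexGaussian_monomial (a b : ℕ) :
    Integrable (fun w : ℂ => w ^ a * conj w ^ b) complexGaussian := by
  rw [complexGaussian, integrable_withDensity_iff_integrable_smul' measurable_gaussianDensity
    (by simp)]
  simp_rw [toReal_gaussianDensity]
  refine ((integrable_norm_pow_mul_exp (a + b)).div_const Real.pi).mono' ?_ ?_
  · exact Continuous.aestronglyMeasurable (by fun_prop)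
  · refine .of_forall fun w => le_of_eq ?_
    rw [norm_smul, Real.norm_of_nonneg (by positivity)]
    simp only [norm_mul, norm_pow, RCLike.norm_conj]
    ring

instance : IsFiniteMeasure complexGaussian := by
  have h := integrable_complexGaussian_monomial 0 0
  simp only [pow_zero, mul_one] at h
  exact (integrable_const_iff_isFiniteMeasure one_ne_zero).1 h

theorem integral_complexGaussian_monomial (a b : ℕ) :
    ∫ w, w ^ a * conj w ^ b ∂complexGaussian = if a = b then (a.factorial : ℂ) else 0 := by
  rw [complexGaussian, integral_withDensity_eq_integral_toReal_smul measurable_gaussianDensity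
    (by simp)]
  simp_rw [toReal_gaussianDensity]
  split_ifs with hab
  · subst hab
    have h : ∀ w : ℂ, (Real.exp (-‖w‖ ^ 2) / Real.pi) • (w ^ a * conj w ^ a)
        = ((‖w‖ ^ (2 * a) * Real.exp (-‖w‖ ^ 2) / Real.pi : ℝ) : ℂ) := by
      intro w
      rw [← mul_pow, Complex.mul_conj', Complex.real_smul, pow_mul]
      push_cast
      ring
    simp_rw [h]
    rw [integral_complex_ofReal, integral_div, integral_norm_pow_mul_exp,
      mul_div_cancel_left₀ _ Real.pi_ne_zero]
    have : (((2 * a : ℕ) : ℝ) + 2) / 2 = a + 1 := by push_cast; ring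
    rw [this, Real.Gamma_nat_eq_factorial]
    norm_cast
  · set G : ℂ → ℂ := fun w => (Real.exp (-‖w‖ ^ 2) / Real.pi) • (w ^ a * conj w ^ b)
    have key : ∀ θ : ℝ, ∫ w, G w = Complex.exp (θ * (a - b) * I) * ∫ w, G w := by
      intro θ
      have hmp := (rotation (Circle.exp θ)).measurePreserving
      refine (hmp.integral_comp (rotation (Circle.exp θ)).toHomeomorph.measurableEmbedding
        G).symm.trans ?_
      rw [← integral_const_mul]
      congr 1
      funext w
      simp only [G, rotation_apply, norm_mul, Circle.norm_coe, one_mul]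
      simp only [Circle.coe_exp, map_mul, mul_pow, ← Complex.exp_conj, conj_ofReal, conj_I,
        Complex.real_smul, ← Complex.exp_nat_mul]
      have : Complex.exp (θ * (a - b) * I)
          = Complex.exp (a * (θ * I)) * Complex.exp (b * (θ * -I)) := by
        rw [← Complex.exp_add]; ring_nf
      rw [this]
      ring
    have hne : ((a : ℂ) - b) ≠ 0 := sub_ne_zero.2 (by exact_mod_cast hab)
    have h1 := key (Real.pi / ((a : ℝ) - b))
    have h2 : (((Real.pi / ((a : ℝ) - b) : ℝ) : ℂ) * (a - b) * I) = Real.pi * I := by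
      push_cast
      field_simp
    rw [h2, Complex.exp_pi_mul_I] at h1
    linear_combination h1 / 2

end Gaussian

/-! ### Moments of standard complex Gaussian vectors -/

section GaussianVector

open Complex ComplexConjugate

variable {Y : Type*} [Fintype Y]

/-- The law of a vector of independent standard complex Gaussians. -/
def gaussianVec (Y : Type*) [Fintype Y] : Measure (Y → ℂ) :=
  Measure.pi fun _ => complexGaussian

theorem integrable_gaussianVec_monomial (S T : Y → ℕ) :
    Integrable (fun w : Y → ℂ => ∏ y, (w y ^ S y * conj (w y) ^ T y)) (gaussianVec Y) :=
  Integrable.fintype_prod (f := fun y (w : ℂ) => w ^ S y * conj w ^ T y)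
    fun _ => integrable_complexGaussian_monomial _ _

theorem integral_gaussianVec_monomial [DecidableEq Y] (S T : Y → ℕ) :
    ∫ w, ∏ y, (w y ^ S y * conj (w y) ^ T y) ∂gaussianVec Y
      = if S = T then (∏ y, ((S y).factorial : ℂ)) else 0 := by
  rw [gaussianVec, integral_fintype_prod_eq_prod (fun y (w : ℂ) => w ^ S y * conj w ^ T y)]
  simp_rw [integral_complexGaussian_monomial]
  split_ifs with h
  · subst h; simp
  · obtain ⟨y, hy⟩ := Function.ne_iff.1 h
    exact Finset.prod_eq_zero (Finset.mem_univ y) (if_neg hy)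

theorem monomial_mul_sum_norm_sq_pow_succ [DecidableEq Y] (S T : Y → ℕ) (l : ℕ) (w : Y → ℂ) :
    (∏ y, (w y ^ S y * conj (w y) ^ T y)) * (∑ y, w y * conj (w y)) ^ (l + 1)
      = ∑ y₀, (∏ y, (w y ^ (S + Pi.single y₀ 1 : Y → ℕ) y * conj (w y) ^ (T + Pi.single y₀ 1 : Y → ℕ) y)) *
          (∑ y, w y * conj (w y)) ^ l := by
  rw [pow_succ, mul_comm (_ ^ l), ← mul_assoc, Finset.mul_sum, Finset.sum_mul]
  refine Finset.sum_congr rfl fun y₀ _ => ?_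
  congr 1
  have : ∀ y, w y ^ (S + Pi.single y₀ 1 : Y → ℕ) y * conj (w y) ^ (T + Pi.single y₀ 1 : Y → ℕ) y
      = (w y ^ S y * conj (w y) ^ T y) * if y = y₀ then w y * conj (w y) else 1 := by
    intro y
    by_cases h : y = y₀
    · subst h; simp [pow_succ]; ring
    · simp [h]
  rw [Finset.prod_congr rfl fun y _ => this y, Finset.prod_mul_distrib (f := fun y => _ * _),
    Finset.prod_ite_eq', if_pos (Finset.mem_univ _)]

theorem integrable_gaussianVec_monomial_mul [DecidableEq Y] (S T : Y → ℕ) (l : ℕ) :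
    Integrable (fun w : Y → ℂ => (∏ y, (w y ^ S y * conj (w y) ^ T y)) *
      (∑ y, w y * conj (w y)) ^ l) (gaussianVec Y) := by
  induction l generalizing S T with
  | zero => simpa using integrable_gaussianVec_monomial S T
  | succ l ih =>
    simp_rw [monomial_mul_sum_norm_sq_pow_succ]
    exact integrable_finsetSum _ fun y₀ _ => ih _ _

theorem integral_gaussianVec_monomial_mul [DecidableEq Y] (S T : Y → ℕ) (l : ℕ) :
    ∫ w, (∏ y, (w y ^ S y * conj (w y) ^ T y)) * (∑ y, w y * conj (w y)) ^ l ∂gaussianVec Y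
      = (((∑ y, S y) + Fintype.card Y).ascFactorial l : ℂ) *
        if S = T then (∏ y, ((S y).factorial : ℂ)) else 0 := by
  induction l generalizing S T with
  | zero => simpa using integral_gaussianVec_monomial S T
  | succ l ih =>
    simp_rw [monomial_mul_sum_norm_sq_pow_succ]
    rw [integral_finsetSum _ fun y₀ _ => integrable_gaussianVec_monomial_mul _ _ _]
    simp_rw [ih]
    have hsum : ∀ y₀ : Y, ∑ y, (S + Pi.single y₀ 1 : Y → ℕ) y = (∑ y, S y) + 1 := by
      intro y₀
      simp [Finset.sum_add_distrib]
    simp_rw [hsum, add_left_inj]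
    by_cases hST : S = T
    · simp only [hST, if_true]
      have hfac : ∀ y₀ : Y, ∏ y, (((T + Pi.single y₀ 1 : Y → ℕ) y).factorial : ℂ)
          = (T y₀ + 1) * ∏ y, ((T y).factorial : ℂ) := by
        intro y₀
        have : ∀ y, (((T + Pi.single y₀ 1 : Y → ℕ) y).factorial : ℂ)
            = ((T y).factorial : ℂ) * if y = y₀ then ((T y : ℂ) + 1) else 1 := by
          intro y
          by_cases h : y = y₀
          · subst h; simp [Nat.factorial_succ]; ring
          · simp [h]
        simp_rw [this]
        rw [Finset.prod_mul_distrib]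
        simp [mul_comm]
      simp_rw [hfac]
      rw [← Finset.mul_sum, ← Finset.sum_mul, Finset.sum_add_distrib,
        add_comm l 1, ← Nat.ascFactorial_mul_ascFactorial]
      simp [Nat.ascFactorial_succ, add_right_comm _ 1]
      ring
    · simp [hST]

end GaussianVector

/-! ### Types of words -/

section WordType

variable {Y : Type*} [DecidableEq Y]

/-- The number of occurrences of each symbol in a word. -/
def wordType {k : ℕ} (z : Fin k → Y) (y : Y) : ℕ :=
  Fintype.card {i // z i = y}

theorem wordType_comp_perm {k : ℕ} (z : Fin k → Y) (σ : Equiv.Perm (Fin k)) :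
    wordType (z ∘ σ) = wordType z :=
  funext fun _ => Fintype.card_congr (σ.subtypeEquiv fun _ => Iff.rfl)

theorem exists_perm_of_wordType_eq {k : ℕ} {z z' : Fin k → Y}
    (h : wordType z = wordType z') : ∃ σ : Equiv.Perm (Fin k), z' ∘ σ = z := by
  have e : ∀ y, {i // z i = y} ≃ {i // z' i = y} := fun y =>
    Fintype.equivOfCardEq (congrFun h y)
  refine ⟨(Equiv.sigmaFiberEquiv z).symm.trans
    ((Equiv.sigmaCongrRight e).trans (Equiv.sigmaFiberEquiv z')), ?_⟩
  funext i
  exact (e (z i) ⟨i, rfl⟩).2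

theorem prod_comp_eq_prod_pow_wordType [Fintype Y] {R : Type*} [CommMonoid R] {k : ℕ}
    (z : Fin k → Y) (f : Y → R) : ∏ i, f (z i) = ∏ y, f y ^ wordType z y := by
  rw [← Finset.prod_fiberwise Finset.univ z]
  refine Finset.prod_congr rfl fun y _ => ?_
  rw [Finset.prod_congr rfl (g := fun _ => f y) (fun i hi => by rw [(Finset.mem_filter.1 hi).2]),
    Finset.prod_const, wordType, Fintype.card_subtype]

theorem sum_wordType [Fintype Y] {k : ℕ} (z : Fin k → Y) : ∑ y, wordType z y = k := by
  have := Finset.card_eq_sum_card_fiberwise (f := z) (s := Finset.univ) (t := Finset.univ)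
    (by simp)
  simp only [Finset.card_univ, Fintype.card_fin] at this
  refine Eq.trans ?_ this.symm
  exact Finset.sum_congr rfl fun y _ => by rw [wordType, Fintype.card_subtype]

theorem factorial_mul_permBlock [Fintype Y] {k : ℕ} (z z' : Fin k → Y) :
    (k.factorial : ℝ) * permBlock z z'
      = if wordType z = wordType z' then ∏ y, ((wordType z y).factorial : ℝ) else 0 := by
  rw [permBlock, mul_div_cancel₀ _ (by positivity)]
  split_ifs with h
  · obtain ⟨τ, rfl⟩ := exists_perm_of_wordType_eq h
    rw [wordType_comp_perm]
    have h1 := DomMulAct.stabilizer_card z'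
    rw [← Nat.cast_prod]
    unfold wordType
    rw [← h1, Fintype.card_subtype]
    congr 1
    refine Finset.card_bij (fun σ _ => σ * τ⁻¹) ?_ (fun _ _ _ _ h => mul_right_cancel h) ?_
    · intro σ hσ
      simp only [Finset.mem_filter, Finset.mem_univ, true_and, Function.comp_apply] at hσ ⊢
      funext i
      simpa using hσ (τ⁻¹ i)
    · intro σ hσ
      simp only [Finset.mem_filter, Finset.mem_univ, true_and] at hσ
      refine ⟨σ * τ, ?_, by simp⟩
      simp only [Finset.mem_filter, Finset.mem_univ, true_and, Function.comp_apply]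
      intro i
      exact congrFun hσ (τ i)
  · rw [Nat.cast_eq_zero, Finset.card_eq_zero, Finset.filter_eq_empty_iff]
    intro σ _ hσ
    exact h (by rw [← wordType_comp_perm z' σ]; congr 1; exact (funext hσ).symm)

theorem prod_comp_eq_of_permBlock_ne_zero {R : Type*} [CommMonoid R] {k : ℕ}
    {z z' : Fin k → Y} (h : permBlock z z' ≠ 0) (f : Y → R) :
    ∏ i, f (z i) = ∏ i, f (z' i) := by
  have h1 : Finset.card {σ : Equiv.Perm (Fin k) | ∀ i, z' (σ i) = z i} ≠ 0 := by
    intro h0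
    simp [permBlock, h0] at h
  obtain ⟨σ, hσ⟩ := Finset.card_ne_zero.1 h1
  simp only [Finset.mem_filter, Finset.mem_univ, true_and] at hσ
  simp_rw [← hσ]
  exact Equiv.prod_comp σ fun i => f (z' i)

theorem permBlock_comm {k : ℕ} (z z' : Fin k → Y) : permBlock z z' = permBlock z' z := by
  unfold permBlock
  congr 2
  refine Finset.card_bij (fun σ _ => σ⁻¹) ?_ (fun _ _ _ _ h => inv_injective h) ?_
  · intro σ hσ
    simp only [Finset.mem_filter, Finset.mem_univ, true_and] at hσ ⊢
    intro i
    simpa using (hσ (σ⁻¹ i)).symm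
  · intro σ hσ
    simp only [Finset.mem_filter, Finset.mem_univ, true_and] at hσ
    refine ⟨σ⁻¹, ?_, by simp⟩
    simp only [Finset.mem_filter, Finset.mem_univ, true_and]
    intro i
    simpa using (hσ (σ⁻¹ i)).symm

end WordType

section GaussianWords

open Complex ComplexConjugate

variable {Y : Type*} [Fintype Y] [DecidableEq Y]

theorem word_mul_conj_word_eq {k : ℕ} (z z' : Fin k → Y) (w : Y → ℂ) :
    (∏ i, w (z i)) * (∏ i, conj (w (z' i)))
      = ∏ y, (w y ^ wordType z y * conj (w y) ^ wordType z' y) := by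
  rw [prod_comp_eq_prod_pow_wordType z, prod_comp_eq_prod_pow_wordType z' fun y => conj (w y),
    Finset.prod_mul_distrib]

theorem integrable_gaussianVec_words {k : ℕ} (z z' : Fin k → Y) (l : ℕ) :
    Integrable (fun w : Y → ℂ => (∏ i, w (z i)) * (∏ i, conj (w (z' i))) *
      (∑ y, w y * conj (w y)) ^ l) (gaussianVec Y) := by
  simp_rw [word_mul_conj_word_eq]
  exact integrable_gaussianVec_monomial_mul _ _ _

theorem integral_gaussianVec_words {k : ℕ} (z z' : Fin k → Y) (l : ℕ) :
    ∫ w, (∏ i, w (z i)) * (∏ i, conj (w (z' i))) * (∑ y, w y * conj (w y)) ^ l ∂gaussianVec Y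
      = ((k.factorial * (k + Fintype.card Y).ascFactorial l * permBlock z z' : ℝ) : ℂ) := by
  simp_rw [word_mul_conj_word_eq]
  rw [integral_gaussianVec_monomial_mul, sum_wordType, mul_right_comm,
    factorial_mul_permBlock]
  split_ifs
  · push_cast; ring
  · simp

end GaussianWords

/-! ### Gaussian integrals of products of linear forms -/

section LinearForms

open Complex ComplexConjugate

variable {Y : Type*} [Fintype Y]

theorem ofReal_prod_norm_sq_linearForm {k : ℕ} (a : Fin k → Y → ℝ) (l : ℕ) (w : Y → ℂ) :
    (((∏ i, ‖∑ y, (a i y : ℂ) * w y‖ ^ 2) * (∑ y, ‖w y‖ ^ 2) ^ l : ℝ) : ℂ)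
      = ∑ z : Fin k → Y, ∑ z' : Fin k → Y,
          (((∏ i, a i (z i)) * (∏ i, a i (z' i)) : ℝ) : ℂ) *
            ((∏ i, w (z i)) * (∏ i, conj (w (z' i))) * (∑ y, w y * conj (w y)) ^ l) := by
  have h1 : ∀ i, ((‖∑ y, (a i y : ℂ) * w y‖ : ℂ)) ^ 2
      = (∑ y, (a i y : ℂ) * w y) * ∑ y, (a i y : ℂ) * conj (w y) := by
    intro i
    rw [← Complex.mul_conj']
    simp
  push_cast
  simp_rw [h1, ← Complex.mul_conj']
  rw [Finset.prod_mul_distrib, Fintype.prod_sum, Fintype.prod_sum, Finset.sum_mul_sum,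
    Finset.sum_mul]
  refine Finset.sum_congr rfl fun z _ => ?_
  rw [Finset.sum_mul]
  refine Finset.sum_congr rfl fun z' _ => ?_
  simp_rw [Finset.prod_mul_distrib]
  ring

variable [DecidableEq Y]

theorem integrable_prod_norm_sq_linearForm {k : ℕ} (a : Fin k → Y → ℝ) (l : ℕ) :
    Integrable (fun w : Y → ℂ => (∏ i, ‖∑ y, (a i y : ℂ) * w y‖ ^ 2) * (∑ y, ‖w y‖ ^ 2) ^ l)
      (gaussianVec Y) := by
  have h : Integrable (fun w : Y → ℂ =>
      (((∏ i, ‖∑ y, (a i y : ℂ) * w y‖ ^ 2) * (∑ y, ‖w y‖ ^ 2) ^ l : ℝ) : ℂ))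
      (gaussianVec Y) := by
    simp_rw [ofReal_prod_norm_sq_linearForm]
    exact integrable_finsetSum _ fun z _ => integrable_finsetSum _ fun z' _ =>
      (integrable_gaussianVec_words z z' l).const_mul _
  exact h.re

theorem integral_prod_norm_sq_linearForm {k : ℕ} (a : Fin k → Y → ℝ) (l : ℕ) :
    ∫ w, (∏ i, ‖∑ y, (a i y : ℂ) * w y‖ ^ 2) * (∑ y, ‖w y‖ ^ 2) ^ l ∂gaussianVec Y
      = k.factorial * (k + Fintype.card Y).ascFactorial l *
        ∑ z : Fin k → Y, ∑ z' : Fin k → Y,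
          (∏ i, a i (z i)) * (∏ i, a i (z' i)) * permBlock z z' := by
  apply Complex.ofReal_injective
  rw [← integral_complex_ofReal]
  simp_rw [ofReal_prod_norm_sq_linearForm]
  rw [integral_finsetSum _ fun z _ => integrable_finsetSum _ fun z' _ =>
      (integrable_gaussianVec_words z z' l).const_mul _]
  simp_rw [integral_finsetSum _ fun z' _ =>
      (integrable_gaussianVec_words _ z' l).const_mul _, integral_const_mul,
      integral_gaussianVec_words]
  rw [Finset.mul_sum, Complex.ofReal_sum]
  refine Finset.sum_congr rfl fun z _ => ?_
  rw [Finset.mul_sum, Complex.ofReal_sum]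
  refine Finset.sum_congr rfl fun z' _ => ?_
  push_cast
  ring

theorem sum_prod_mul_prod_mul_permBlock {k : ℕ} (v : Y → ℝ) :
    ∑ z : Fin k → Y, ∑ z' : Fin k → Y, (∏ i, v (z i)) * (∏ i, v (z' i)) * permBlock z z'
      = (∑ y, v y ^ 2) ^ k := by
  have h : ∀ z z' : Fin k → Y, (∏ i, v (z i)) * (∏ i, v (z' i)) * permBlock z z'
      = (∏ i, v (z i) ^ 2) * permBlock z z' := by
    intro z z'
    by_cases h0 : permBlock z z' = 0
    · simp [h0]
    · rw [← prod_comp_eq_of_permBlock_ne_zero h0, ← sq, Finset.prod_pow]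
  simp_rw [h, ← Finset.mul_sum, sum_permBlock, mul_one]
  rw [← Fintype.prod_sum fun (_ : Fin k) y => v y ^ 2]
  simp

theorem integrable_norm_sq_pow_mul (v : Y → ℝ) (k l : ℕ) :
    Integrable (fun w : Y → ℂ => (‖∑ y, (v y : ℂ) * w y‖ ^ 2) ^ k * (∑ y, ‖w y‖ ^ 2) ^ l)
      (gaussianVec Y) := by
  simpa using integrable_prod_norm_sq_linearForm (fun _ : Fin k => v) l

theorem integral_norm_sq_pow_mul {v : Y → ℝ} (hv : ∑ y, v y ^ 2 = 1) (k l : ℕ) :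
    ∫ w, (‖∑ y, (v y : ℂ) * w y‖ ^ 2) ^ k * (∑ y, ‖w y‖ ^ 2) ^ l ∂gaussianVec Y
      = k.factorial * (k + Fintype.card Y).ascFactorial l := by
  have h := integral_prod_norm_sq_linearForm (fun _ : Fin k => v) l
  rw [sum_prod_mul_prod_mul_permBlock, hv, one_pow, mul_one] at h
  simpa using h

theorem sum_binomial_ascFactorial_le {α ρ : ℝ} (hα : 0 < α) (hρ : 0 ≤ ρ) (h1 : α + ρ = 1)
    (n m : ℕ) :
    ∑ k ∈ Finset.range (n + 1), α ^ k * ρ ^ (n - k) * n.choose k *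
        (k.factorial * (k + (m + 1)).ascFactorial (n - k))
      ≤ n.factorial * α⁻¹ ^ m := by
  have hterm : ∀ k ∈ Finset.range (n + 1), α ^ k * ρ ^ (n - k) * n.choose k *
        (k.factorial * (k + (m + 1)).ascFactorial (n - k))
      = n.factorial * α⁻¹ ^ m * (ρ ^ (n - k) * α ^ (n + m - (n - k)) *
        (n + m).choose (n - k)) := by
    intro k hk
    have hkn : k ≤ n := Nat.lt_succ_iff.1 (Finset.mem_range.1 hk)
    have e1 : n + m - (n - k) = k + m := by omega
    have e2 : k + m + (n - k) = n + m := by omega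
    have e3 : k + (m + 1) = k + m + 1 := by omega
    have hf : (n.choose k * k.factorial * (n - k).factorial : ℝ) = n.factorial := by
      exact_mod_cast Nat.choose_mul_factorial_mul_factorial hkn
    rw [e1, e3, Nat.ascFactorial_eq_factorial_mul_choose, e2, ← hf, pow_add, inv_pow]
    push_cast
    field_simp
  rw [Finset.sum_congr rfl hterm, ← Finset.mul_sum]
  refine mul_le_of_le_one_right (by positivity) ?_
  have hrefl := Finset.sum_range_reflect
    (fun j => ρ ^ j * α ^ (n + m - j) * ((n + m).choose j : ℝ)) (n + 1)
  simp only [Nat.add_sub_cancel] at hrefl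
  rw [hrefl]
  calc ∑ j ∈ Finset.range (n + 1), ρ ^ j * α ^ (n + m - j) * ((n + m).choose j : ℝ)
      ≤ ∑ j ∈ Finset.range (n + m + 1), ρ ^ j * α ^ (n + m - j) * ((n + m).choose j : ℝ) :=
        Finset.sum_le_sum_of_subset_of_nonneg (Finset.range_mono (by omega))
          fun _ _ _ => by positivity
    _ = 1 := by rw [← add_pow, add_comm ρ, h1, one_pow]

theorem integral_quadratic_pow_le [Nonempty Y] {v : Y → ℝ} (hv : ∑ y, v y ^ 2 = 1) {α ρ : ℝ}
    (hα : 0 < α) (hρ : 0 ≤ ρ) (h1 : α + ρ = 1) (n : ℕ) :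
    Integrable (fun w : Y → ℂ => (α * ‖∑ y, (v y : ℂ) * w y‖ ^ 2 + ρ * ∑ y, ‖w y‖ ^ 2) ^ n)
      (gaussianVec Y) ∧
    ∫ w, (α * ‖∑ y, (v y : ℂ) * w y‖ ^ 2 + ρ * ∑ y, ‖w y‖ ^ 2) ^ n ∂gaussianVec Y
      ≤ n.factorial * α⁻¹ ^ (Fintype.card Y - 1) := by
  have hpt : ∀ w : Y → ℂ, (α * ‖∑ y, (v y : ℂ) * w y‖ ^ 2 + ρ * ∑ y, ‖w y‖ ^ 2) ^ n
      = ∑ k ∈ Finset.range (n + 1), α ^ k * ρ ^ (n - k) * n.choose k *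
        ((‖∑ y, (v y : ℂ) * w y‖ ^ 2) ^ k * (∑ y, ‖w y‖ ^ 2) ^ (n - k)) := by
    intro w
    rw [add_pow]
    refine Finset.sum_congr rfl fun k _ => ?_
    rw [mul_pow, mul_pow]
    ring
  simp_rw [hpt]
  have hint : ∀ k ∈ Finset.range (n + 1), Integrable (fun w : Y → ℂ =>
      α ^ k * ρ ^ (n - k) * n.choose k *
        ((‖∑ y, (v y : ℂ) * w y‖ ^ 2) ^ k * (∑ y, ‖w y‖ ^ 2) ^ (n - k))) (gaussianVec Y) :=
    fun k _ => (integrable_norm_sq_pow_mul v k (n - k)).const_mul _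
  refine ⟨integrable_finsetSum _ hint, ?_⟩
  rw [integral_finsetSum _ hint]
  simp_rw [integral_const_mul, integral_norm_sq_pow_mul hv]
  obtain ⟨m, hm⟩ : ∃ m, Fintype.card Y = m + 1 := Nat.exists_eq_succ_of_ne_zero Fintype.card_ne_zero
  rw [hm, Nat.add_sub_cancel]
  exact sum_binomial_ascFactorial_le hα hρ h1 n m

end LinearForms

/-! ### The second moment of the likelihood ratio -/

section SecondMoment

variable {X Y : Type*} [Fintype Y] [DecidableEq Y]

theorem wordType_eq_of_permBlock_ne_zero {k : ℕ} {z z' : Fin k → Y} (h : permBlock z z' ≠ 0) :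
    wordType z = wordType z' := by
  by_contra hne
  have := factorial_mul_permBlock z z'
  rw [if_neg hne] at this
  exact (mul_ne_zero (by positivity) h) this

theorem permBlock_eq_of_wordType_eq {k : ℕ} (z : Fin k → Y) {y y' : Fin k → Y}
    (h : wordType y = wordType y') : permBlock z y = permBlock z y' := by
  have h0 : (k.factorial : ℝ) ≠ 0 := by positivity
  apply mul_left_cancel₀ h0
  rw [factorial_mul_permBlock, factorial_mul_permBlock, h]

theorem sum_sq_permKernel_div_eq (W : Matrix X Y ℝ) {n : ℕ} (x : Fin n → X) {q : Y → ℝ}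
    (hq : ∀ y, 0 < q y) :
    ∑ y : Fin n → Y, permKernel W x y ^ 2 / ∏ i, q (y i)
      = ∑ z : Fin n → Y, ∑ z' : Fin n → Y,
        (∏ i, W (x i) (z i) / √(q (z i))) * (∏ i, W (x i) (z' i) / √(q (z' i))) *
          permBlock z z' := by
  have h1 : ∀ y : Fin n → Y, permKernel W x y ^ 2 / ∏ i, q (y i)
      = ∑ z : Fin n → Y, dmcLaw W x z * (permKernel W x z / ∏ i, q (z i)) * permBlock z y := by
    intro y
    rw [sq, mul_div_assoc]
    conv_lhs => rw [permKernel]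
    rw [Finset.sum_mul]
    refine Finset.sum_congr rfl fun z _ => ?_
    by_cases h0 : permBlock z y = 0
    · simp [h0]
    · rw [prod_comp_eq_of_permBlock_ne_zero h0]
      have : permKernel W x z = permKernel W x y := by
        unfold permKernel
        refine Finset.sum_congr rfl fun z' _ => ?_
        rw [permBlock_eq_of_wordType_eq z' (wordType_eq_of_permBlock_ne_zero h0)]
      rw [this, permKernel]
      ring
  simp_rw [h1]
  rw [Finset.sum_comm]
  simp_rw [← Finset.mul_sum, sum_permBlock, mul_one]
  refine Finset.sum_congr rfl fun z _ => ?_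
  rw [permKernel, Finset.sum_div, Finset.mul_sum]
  refine Finset.sum_congr rfl fun z' _ => ?_
  rw [permBlock_comm z' z]
  by_cases h0 : permBlock z z' = 0
  · simp [h0]
  · have hs : ∏ i, q (z i) = (∏ i, √(q (z i))) * ∏ i, √(q (z' i)) := by
      rw [← prod_comp_eq_of_permBlock_ne_zero h0 fun y => √(q y), ← Finset.prod_mul_distrib]
      exact Finset.prod_congr rfl fun i _ => (Real.mul_self_sqrt (hq _).le).symm
    rw [hs, Finset.prod_div_distrib, Finset.prod_div_distrib, dmcLaw, dmcLaw]
    have e1 : ∏ i, √(q (z i)) ≠ 0 :=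
      Finset.prod_ne_zero_iff.2 fun i _ => (Real.sqrt_pos.2 (hq _)).ne'
    have e2 : ∏ i, √(q (z' i)) ≠ 0 :=
      Finset.prod_ne_zero_iff.2 fun i _ => (Real.sqrt_pos.2 (hq _)).ne'
    field_simp

theorem prod_le_mean_pow {n : ℕ} (hn : n ≠ 0) {t : Fin n → ℝ} (ht : ∀ i, 0 ≤ t i) :
    ∏ i, t i ≤ ((∑ i, t i) / n) ^ n := by
  have hn' : (n : ℝ) ≠ 0 := by exact_mod_cast hn
  have h := Real.geom_mean_le_arith_mean_weighted Finset.univ (fun _ => (n : ℝ)⁻¹) t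
    (fun _ _ => by positivity) (by simp [hn']) fun i _ => ht i
  rw [← Finset.mul_sum, ← div_eq_inv_mul] at h
  calc ∏ i, t i = (∏ i, t i ^ (n : ℝ)⁻¹) ^ n := by
        rw [← Finset.prod_pow]
        exact Finset.prod_congr rfl fun i _ => (Real.rpow_inv_natCast_pow (ht i) hn).symm
    _ ≤ _ := pow_le_pow_left₀ (Finset.prod_nonneg fun i _ => Real.rpow_nonneg (ht i) _) h n

/-- If the average of the squared linear forms `w ↦ ∑ y, W(y|xᵢ) w_y / √q_y` is dominated by a
quadratic form with eigenvalue `K` along `√q` and `K * ρ` on the complement, then the second moment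
of the likelihood ratio between the output law of `x` and the product law of `q` is bounded. -/
theorem sum_sq_permKernel_div_le [Nonempty Y] (W : Matrix X Y ℝ) {n : ℕ} (hn : n ≠ 0)
    (x : Fin n → X) {q : Y → ℝ} (hq : ∀ y, 0 < q y) (hq1 : ∑ y, q y = 1) {α ρ K : ℝ}
    (hα : 0 < α) (hρ : 0 ≤ ρ) (h1 : α + ρ = 1) (hK : 0 ≤ K)
    (hquad : ∀ w : Y → ℂ, (∑ i, ‖∑ y, ((W (x i) y / √(q y) : ℝ) : ℂ) * w y‖ ^ 2) / n
      ≤ K * (α * ‖∑ y, ((√(q y) : ℝ) : ℂ) * w y‖ ^ 2 + ρ * ∑ y, ‖w y‖ ^ 2)) :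
    ∑ y : Fin n → Y, permKernel W x y ^ 2 / ∏ i, q (y i)
      ≤ K ^ n * α⁻¹ ^ (Fintype.card Y - 1) := by
  have hv : ∑ y, √(q y) ^ 2 = 1 := by
    rw [← hq1]
    exact Finset.sum_congr rfl fun y _ => Real.sq_sqrt (hq y).le
  obtain ⟨hint, hle⟩ := integral_quadratic_pow_le hv hα hρ h1 n
  have hfac : (0 : ℝ) < n.factorial := by positivity
  have hA := integrable_prod_norm_sq_linearForm (fun i y => W (x i) y / √(q y)) 0
  have hB := integral_prod_norm_sq_linearForm (fun i y => W (x i) y / √(q y)) 0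
  simp only [pow_zero, mul_one, Nat.ascFactorial_zero, Nat.cast_one] at hA hB
  rw [← sum_sq_permKernel_div_eq W x hq] at hB
  have hmono : n.factorial * ∑ y : Fin n → Y, permKernel W x y ^ 2 / ∏ i, q (y i)
      ≤ K ^ n * (n.factorial * α⁻¹ ^ (Fintype.card Y - 1)) := by
    rw [← hB]
    refine le_trans ?_ (mul_le_mul_of_nonneg_left hle (by positivity))
    rw [← integral_const_mul]
    refine integral_mono hA (hint.const_mul _) fun w => ?_
    simp only
    rw [← mul_pow]
    refine (prod_le_mean_pow hn fun i => by positivity).trans ?_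
    exact pow_le_pow_left₀ (by positivity) (hquad w) n
  refine le_of_mul_le_mul_left ?_ hfac
  linarith

end SecondMoment

/-! ### The quadratic form of a codeword -/

section QuadraticForm

theorem norm_sq_sum_smul_le {Y : Type*} [Fintype Y] (p : Y → ℝ) (hp : ∀ y, 0 ≤ p y) (g : Y → ℂ) :
    ‖∑ y, p y • g y‖ ^ 2 ≤ (∑ y, p y) * ∑ y, p y * ‖g y‖ ^ 2 := by
  have h1 : ‖∑ y, p y • g y‖ ≤ ∑ y, p y * ‖g y‖ := by
    refine (norm_sum_le _ _).trans (Finset.sum_le_sum fun y _ => ?_)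
    rw [norm_smul, Real.norm_of_nonneg (hp y)]
  refine (pow_le_pow_left₀ (norm_nonneg _) h1 2).trans ?_
  refine Finset.sum_sq_le_sum_mul_sum_of_sq_le_mul _ (fun y _ => hp y)
    (fun y _ => mul_nonneg (hp y) (by positivity)) fun y _ => le_of_eq (by ring)

variable {X Y : Type*}

/-- The average output distribution of a codeword. -/
def meanOutput (W : Matrix X Y ℝ) {n : ℕ} (x : Fin n → X) (y : Y) : ℝ :=
  (∑ i, W (x i) y) / n

theorem le_meanOutput {W : Matrix X Y ℝ} {c : ℝ} (hc : ∀ x y, c ≤ W x y) {n : ℕ} (hn : n ≠ 0)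
    (x : Fin n → X) (y : Y) : c ≤ meanOutput W x y := by
  have hn' : (0 : ℝ) < n := by positivity
  rw [meanOutput, le_div_iff₀ hn']
  calc c * n = ∑ _i : Fin n, c := by simp [mul_comm]
    _ ≤ _ := Finset.sum_le_sum fun i _ => hc _ _

variable [Fintype Y]

theorem sum_meanOutput {W : Matrix X Y ℝ} (hW : IsChannel W) {n : ℕ} (hn : n ≠ 0)
    (x : Fin n → X) : ∑ y, meanOutput W x y = 1 := by
  have hn' : (n : ℝ) ≠ 0 := by exact_mod_cast hn
  simp only [meanOutput]
  rw [← Finset.sum_div, Finset.sum_comm]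
  simp [hW.row_sum, hn']

theorem mean_norm_sq_add_le {W : Matrix X Y ℝ} (hW : IsChannel W) {c : ℝ} (hc0 : 0 < c)
    (hc : ∀ x y, c ≤ W x y) {n : ℕ} (hn : n ≠ 0) (x : Fin n → X) {q : Y → ℝ}
    (hq : ∀ y, c ≤ q y) (hq1 : ∑ y, q y = 1)
    (hclose : ∑ y, (meanOutput W x y - q y) ^ 2 ≤ c ^ 4 / (2 * n)) (μ : ℂ) (g : Y → ℂ)
    (hg : ∑ y, q y • g y = 0) :
    (∑ i, ‖μ + ∑ y, W (x i) y • g y‖ ^ 2) / n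
      ≤ (1 + 1 / n) * (‖μ‖ ^ 2 + (1 - c / 2) * ∑ y, q y * ‖g y‖ ^ 2) := by
  have hn' : (0 : ℝ) < n := by positivity
  have hn1 : (1 : ℝ) ≤ n := by exact_mod_cast Nat.one_le_iff_ne_zero.2 hn
  have hq01 : ∀ y, q y ≤ 1 := fun y => hq1 ▸
    Finset.single_le_sum (fun y _ => hc0.le.trans (hq y)) (Finset.mem_univ y)
  obtain ⟨y₀⟩ : Nonempty Y := by
    by_contra h
    rw [not_nonempty_iff] at h
    simp at hq1
  have hc1 : c ≤ 1 := (hq y₀).trans (hq01 y₀)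
  set V := ∑ y, q y * ‖g y‖ ^ 2 with hV
  set h : Fin n → ℂ := fun i => ∑ y, W (x i) y • g y with hh
  set m : ℂ := ∑ y, meanOutput W x y • g y with hm
  have hV0 : 0 ≤ V := Finset.sum_nonneg fun y _ =>
    mul_nonneg (hc0.le.trans (hq y)) (by positivity)
  have hsumh : ∑ i, h i = (n : ℝ) • m := by
    simp only [hh, hm, meanOutput]
    rw [Finset.sum_comm, Finset.smul_sum]
    refine Finset.sum_congr rfl fun y _ => ?_
    rw [← Finset.sum_smul, smul_smul, mul_div_cancel₀ _ hn'.ne']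
  have hexp : (∑ i, ‖μ + h i‖ ^ 2) / n
      = ‖μ‖ ^ 2 + 2 * inner ℝ μ m + (∑ i, ‖h i‖ ^ 2) / n := by
    simp_rw [norm_add_sq_real]
    rw [Finset.sum_add_distrib, Finset.sum_add_distrib, ← Finset.mul_sum, ← inner_sum, hsumh,
      inner_smul_right]
    simp
    field_simp
  have hm2 : ‖m‖ ^ 2 ≤ c / (2 * n) * V := by
    have e1 : m = ∑ y, (meanOutput W x y - q y) • g y := by
      simp_rw [sub_smul]
      rw [Finset.sum_sub_distrib, hg, sub_zero]
    have e2 : ‖m‖ ≤ ∑ y, |meanOutput W x y - q y| * ‖g y‖ := by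
      rw [e1]
      refine (norm_sum_le _ _).trans (Finset.sum_le_sum fun y _ => ?_)
      rw [norm_smul, Real.norm_eq_abs]
    have e3 : c * ∑ y, ‖g y‖ ^ 2 ≤ V := by
      rw [Finset.mul_sum]
      exact Finset.sum_le_sum fun y _ => by gcongr; exact hq y
    have e4 : c ^ 4 / (2 * n) * ∑ y, ‖g y‖ ^ 2 ≤ c / (2 * n) * V := by
      calc c ^ 4 / (2 * n) * ∑ y, ‖g y‖ ^ 2 = c ^ 2 * (c / (2 * n) * (c * ∑ y, ‖g y‖ ^ 2)) := by
            ring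
        _ ≤ 1 * (c / (2 * n) * V) := by
            gcongr
            exact pow_le_one₀ hc0.le hc1
        _ = _ := one_mul _
    calc ‖m‖ ^ 2 ≤ (∑ y, |meanOutput W x y - q y| * ‖g y‖) ^ 2 := by gcongr
      _ ≤ (∑ y, |meanOutput W x y - q y| ^ 2) * ∑ y, ‖g y‖ ^ 2 :=
        Finset.sum_mul_sq_le_sq_mul_sq _ _ _
      _ ≤ c ^ 4 / (2 * n) * ∑ y, ‖g y‖ ^ 2 := by
        simp_rw [sq_abs]
        gcongr
      _ ≤ _ := e4
  have hinner : 2 * inner ℝ μ m ≤ ‖μ‖ ^ 2 / n + c / 2 * V := by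
    have e1 : inner ℝ μ m ≤ ‖μ‖ * ‖m‖ := real_inner_le_norm _ _
    have e2 : 2 * (‖μ‖ * ‖m‖) ≤ ‖μ‖ ^ 2 / n + n * ‖m‖ ^ 2 := by
      have : ‖μ‖ ^ 2 / n + n * ‖m‖ ^ 2 - 2 * (‖μ‖ * ‖m‖) = (‖μ‖ - n * ‖m‖) ^ 2 / n := by
        field_simp
        ring
      have : 0 ≤ (‖μ‖ - n * ‖m‖) ^ 2 / n := by positivity
      linarith
    have e3 : n * ‖m‖ ^ 2 ≤ c / 2 * V := by
      calc n * ‖m‖ ^ 2 ≤ n * (c / (2 * n) * V) := by gcongr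
        _ = _ := by field_simp
    linarith
  have hhi : ∀ i, ‖h i‖ ^ 2 ≤ (1 - c) * ∑ y, (W (x i) y - c * q y) * ‖g y‖ ^ 2 := by
    intro i
    have e0 : ∀ y, 0 ≤ W (x i) y - c * q y := fun y => by
      have := mul_le_mul_of_nonneg_left (hq01 y) hc0.le
      linarith [hc (x i) y]
    have e1 : h i = ∑ y, (W (x i) y - c * q y) • g y := by
      simp_rw [sub_smul, mul_smul]
      rw [Finset.sum_sub_distrib, ← Finset.smul_sum, hg, smul_zero, sub_zero]
    have e2 : ∑ y, (W (x i) y - c * q y) = 1 - c := by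
      rw [Finset.sum_sub_distrib, ← Finset.mul_sum, hq1, hW.row_sum, mul_one]
    rw [e1, ← e2]
    exact norm_sq_sum_smul_le _ e0 g
  have hvar : (∑ i, ‖h i‖ ^ 2) / n ≤ (1 - c) * V := by
    have e1 : (∑ i, (1 - c) * ∑ y, (W (x i) y - c * q y) * ‖g y‖ ^ 2) / n
        = (1 - c) * ∑ y, (meanOutput W x y - c * q y) * ‖g y‖ ^ 2 := by
      rw [← Finset.mul_sum, Finset.sum_comm, mul_div_assoc, Finset.sum_div]
      congr 1
      refine Finset.sum_congr rfl fun y _ => ?_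
      rw [← Finset.sum_mul, Finset.sum_sub_distrib, meanOutput]
      simp
      field_simp
    have e2 : ∀ y, meanOutput W x y - c * q y ≤ q y := by
      intro y
      have f1 : (meanOutput W x y - q y) ^ 2 ≤ (c ^ 2) ^ 2 := by
        calc (meanOutput W x y - q y) ^ 2 ≤ ∑ y, (meanOutput W x y - q y) ^ 2 :=
              Finset.single_le_sum (f := fun y => (meanOutput W x y - q y) ^ 2)
                (fun y _ => sq_nonneg _) (Finset.mem_univ y)
          _ ≤ c ^ 4 / (2 * n) := hclose
          _ ≤ c ^ 4 := div_le_self (by positivity) (by linarith)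
          _ = _ := by ring
      have f2 := (abs_le_of_sq_le_sq' f1 (by positivity)).2
      have f3 : c ^ 2 ≤ c * q y := by
        rw [sq]
        exact mul_le_mul_of_nonneg_left (hq y) hc0.le
      linarith
    calc (∑ i, ‖h i‖ ^ 2) / n
        ≤ (∑ i, (1 - c) * ∑ y, (W (x i) y - c * q y) * ‖g y‖ ^ 2) / n := by
          gcongr with i _
          exact hhi i
      _ = _ := e1
      _ ≤ (1 - c) * V := by
          refine mul_le_mul_of_nonneg_left ?_ (by linarith)
          exact Finset.sum_le_sum fun y _ => by gcongr; exact e2 y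
  have hfin : 0 ≤ 1 / (n : ℝ) * ((1 - c / 2) * V) :=
    mul_nonneg (by positivity) (mul_nonneg (by linarith) hV0)
  calc (∑ i, ‖μ + h i‖ ^ 2) / n = _ := hexp
    _ ≤ ‖μ‖ ^ 2 + (‖μ‖ ^ 2 / n + c / 2 * V) + (1 - c) * V := by gcongr
    _ ≤ _ := by
      have : (1 + 1 / (n : ℝ)) * (‖μ‖ ^ 2 + (1 - c / 2) * V)
          = ‖μ‖ ^ 2 + (‖μ‖ ^ 2 / n + c / 2 * V) + (1 - c) * V
            + 1 / (n : ℝ) * ((1 - c / 2) * V) := by ring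
      linarith

theorem mean_norm_sq_linearForm_le {W : Matrix X Y ℝ} (hW : IsChannel W) {c : ℝ} (hc0 : 0 < c)
    (hc : ∀ x y, c ≤ W x y) {n : ℕ} (hn : n ≠ 0) (x : Fin n → X) {q : Y → ℝ}
    (hq : ∀ y, c ≤ q y) (hq1 : ∑ y, q y = 1)
    (hclose : ∑ y, (meanOutput W x y - q y) ^ 2 ≤ c ^ 4 / (2 * n)) (w : Y → ℂ) :
    (∑ i, ‖∑ y, ((W (x i) y / √(q y) : ℝ) : ℂ) * w y‖ ^ 2) / n
      ≤ (1 + 1 / n) * (c / 2 * ‖∑ y, ((√(q y) : ℝ) : ℂ) * w y‖ ^ 2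
        + (1 - c / 2) * ∑ y, ‖w y‖ ^ 2) := by
  have hq0 : ∀ y, 0 < q y := fun y => hc0.trans_le (hq y)
  have hs : ∀ y, √(q y) ≠ 0 := fun y => (Real.sqrt_pos.2 (hq0 y)).ne'
  set μ : ℂ := ∑ y, ((√(q y) : ℝ) : ℂ) * w y with hμ
  set g : Y → ℂ := fun y => (√(q y))⁻¹ • w y - μ with hgdef
  have hw : ∀ y, w y = √(q y) • (μ + g y) := by
    intro y
    simp only [hgdef, add_sub_cancel]
    rw [smul_smul, mul_inv_cancel₀ (hs y), one_smul]
  have hqg : ∑ y, q y • g y = 0 := by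
    have e : ∀ y, q y • g y = ((√(q y) : ℝ) : ℂ) * w y - q y • μ := by
      intro y
      have f : q y * (√(q y))⁻¹ = √(q y) := by
        rw [← div_eq_mul_inv, Real.div_sqrt]
      simp only [hgdef]
      rw [smul_sub, smul_smul, f, Complex.real_smul]
    simp_rw [e]
    rw [Finset.sum_sub_distrib, ← Finset.sum_smul, hq1, one_smul, hμ, sub_self]
  have hL : ∀ i, ∑ y, ((W (x i) y / √(q y) : ℝ) : ℂ) * w y = μ + ∑ y, W (x i) y • g y := by
    intro i
    have e : ∀ y, ((W (x i) y / √(q y) : ℝ) : ℂ) * w y = W (x i) y • μ + W (x i) y • g y := by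
      intro y
      rw [← smul_add, ← Complex.real_smul]
      conv_lhs => rw [hw y]
      rw [smul_smul, div_mul_cancel₀ _ (hs y)]
    simp_rw [e]
    rw [Finset.sum_add_distrib, ← Finset.sum_smul, hW.row_sum, one_smul]
  have hnorm : ∑ y, ‖w y‖ ^ 2 = ‖μ‖ ^ 2 + ∑ y, q y * ‖g y‖ ^ 2 := by
    have e : ∀ y, ‖w y‖ ^ 2
        = q y * ‖μ‖ ^ 2 + 2 * inner ℝ μ (q y • g y) + q y * ‖g y‖ ^ 2 := by
      intro y
      conv_lhs => rw [hw y]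
      rw [norm_smul, mul_pow, Real.norm_eq_abs, sq_abs, Real.sq_sqrt (hq0 y).le, norm_add_sq_real,
        inner_smul_right]
      ring
    simp_rw [e]
    rw [Finset.sum_add_distrib, Finset.sum_add_distrib, ← Finset.sum_mul, hq1, ← Finset.mul_sum,
      ← inner_sum, hqg, inner_zero_right]
    ring
  simp_rw [hL]
  refine (mean_norm_sq_add_le hW hc0 hc hn x hq hq1 hclose μ g hqg).trans (le_of_eq ?_)
  rw [hnorm]
  ring

variable [DecidableEq Y]

/-- The second moment of the likelihood ratio between the output law of a codeword and a product
law is bounded if the mean output of the codeword is at distance `O(1/√n)` from the marginal. -/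
theorem sum_sq_permKernel_div_le_const [Nonempty Y] {W : Matrix X Y ℝ} (hW : IsChannel W) {c : ℝ}
    (hc0 : 0 < c) (hc : ∀ x y, c ≤ W x y) {n : ℕ} (hn : n ≠ 0) (x : Fin n → X) {q : Y → ℝ}
    (hq : ∀ y, c ≤ q y) (hq1 : ∑ y, q y = 1)
    (hclose : ∑ y, (meanOutput W x y - q y) ^ 2 ≤ c ^ 4 / (2 * n)) :
    ∑ y : Fin n → Y, permKernel W x y ^ 2 / ∏ i, q (y i)
      ≤ Real.exp 1 * (c / 2)⁻¹ ^ (Fintype.card Y - 1) := by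
  have hn' : (0 : ℝ) < n := by positivity
  obtain ⟨y₀⟩ := ‹Nonempty Y›
  have hc1 : c ≤ 1 := (hq y₀).trans (hq1 ▸
    Finset.single_le_sum (fun y _ => hc0.le.trans (hq y)) (Finset.mem_univ y₀))
  have : Nonempty Y := ⟨y₀⟩
  refine (sum_sq_permKernel_div_le W hn x (fun y => hc0.trans_le (hq y)) hq1 (half_pos hc0)
    (by linarith) (by ring) (by positivity : (0 : ℝ) ≤ 1 + 1 / n)
    (mean_norm_sq_linearForm_le hW hc0 hc hn x hq hq1 hclose)).trans ?_
  gcongr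
  calc (1 + 1 / (n : ℝ)) ^ n ≤ Real.exp (1 / n) ^ n := by
        gcongr
        rw [add_comm]
        exact Real.add_one_le_exp _
    _ = Real.exp 1 := by
        rw [← Real.exp_nat_mul, mul_one_div_cancel hn'.ne']

end QuadraticForm

/-! ### A converse from second moments of likelihood ratios -/

section Converse

/-- If the messages fall into `|J|` classes such that each law `P u` has a likelihood ratio with
second moment at most `R` with respect to each law `Q u'` of its class, then a decoder with success
probability `s` can only distinguish `R |J| / s²` messages. -/
theorem card_messages_le {Ω J : Type*} [Fintype Ω] [Fintype J] {M : ℕ} (hM : 1 ≤ M)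
    (P Q : Fin M → Ω → ℝ) (hQ : ∀ u ω, 0 < Q u ω) (hQ1 : ∀ u, ∑ ω, Q u ω = 1)
    (dec : Ω → Option (Fin M)) (j : Fin M → J) {R s : ℝ} (hs : 0 < s) (hR : 0 ≤ R)
    (hsec : ∀ u u', j u = j u' → ∑ ω, P u ω ^ 2 / Q u' ω ≤ R)
    (hsucc : s * M ≤ ∑ u, ∑ ω, if dec ω = some u then P u ω else 0) :
    (M : ℝ) ≤ R * Fintype.card J / s ^ 2 := by
  have : Nonempty (Fin M) := ⟨⟨0, hM⟩⟩
  have hM' : (0 : ℝ) < M := by exact_mod_cast hM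
  set r : J → Fin M := Function.invFun j
  have hr : ∀ u, j u = j (r (j u)) := fun u => (Function.invFun_eq ⟨u, rfl⟩).symm
  have hcs : (∑ u, ∑ ω, if dec ω = some u then P u ω else 0) ^ 2
      ≤ (∑ u, ∑ ω, P u ω ^ 2 / Q (r (j u)) ω) *
        ∑ u, ∑ ω, if dec ω = some u then Q (r (j u)) ω else 0 := by
    rw [← Fintype.sum_prod_type', ← Fintype.sum_prod_type', ← Fintype.sum_prod_type']
    refine Finset.sum_sq_le_sum_mul_sum_of_sq_le_mul _
      (fun p _ => div_nonneg (sq_nonneg _) (hQ _ _).le) (fun p _ => ?_) fun p _ => ?_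
    · split_ifs
      exacts [(hQ _ _).le, le_rfl]
    · split_ifs
      · rw [div_mul_cancel₀ _ (hQ _ _).ne']
      · simp
  have h1 : ∑ u, ∑ ω, P u ω ^ 2 / Q (r (j u)) ω ≤ M * R := by
    refine (Finset.sum_le_sum fun u _ => hsec u _ (hr u)).trans ?_
    simp
  have h2 : ∑ u, ∑ ω, (if dec ω = some u then Q (r (j u)) ω else 0) ≤ Fintype.card J := by
    rw [Finset.sum_comm]
    calc ∑ ω, ∑ u, (if dec ω = some u then Q (r (j u)) ω else 0)
        ≤ ∑ ω, ∑ i, Q (r i) ω := by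
          refine Finset.sum_le_sum fun ω _ => ?_
          cases hd : dec ω with
          | none => simpa using Finset.sum_nonneg fun i _ => (hQ (r i) ω).le
          | some v =>
            simp only [Option.some.injEq, Finset.sum_ite_eq, Finset.mem_univ, if_true]
            exact Finset.single_le_sum (f := fun i => Q (r i) ω)
              (fun i _ => (hQ (r i) ω).le) (Finset.mem_univ (j v))
      _ = Fintype.card J := by
          rw [Finset.sum_comm]
          simp [hQ1]
  have h3 : (s * M) ^ 2 ≤ M * R * Fintype.card J := by
    refine (pow_le_pow_left₀ (by positivity) hsucc 2).trans (hcs.trans ?_)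
    refine mul_le_mul h1 h2 (Finset.sum_nonneg fun u _ => Finset.sum_nonneg fun ω _ => ?_)
      (by positivity)
    split_ifs
    exacts [(hQ _ _).le, le_rfl]
  rw [le_div_iff₀ (by positivity)]
  refine le_of_mul_le_mul_left ?_ hM'
  linarith

variable {X Y : Type*} [Fintype Y] [DecidableEq Y]

theorem success_ge {W : Matrix X Y ℝ} (hW : IsChannel W) {n M : ℕ} (hM : 1 ≤ M)
    (c : Code X Y n M) {ε : ℝ} (hε : avgError W c ≤ ε) :
    (1 - ε) * M ≤ ∑ u, ∑ y, if c.dec y = some u then permKernel W (c.enc u) y else 0 := by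
  have hM' : (0 : ℝ) < M := by exact_mod_cast hM
  rw [avgError, div_le_iff₀ hM'] at hε
  have h : ∑ u : Fin M, ∑ y : Fin n → Y,
      (if c.dec y ≠ some u then permKernel W (c.enc u) y else 0)
      + ∑ u : Fin M, ∑ y : Fin n → Y,
      (if c.dec y = some u then permKernel W (c.enc u) y else 0) = M := by
    rw [← Finset.sum_add_distrib]
    have : ∀ u : Fin M, ∑ y : Fin n → Y,
        (if c.dec y ≠ some u then permKernel W (c.enc u) y else 0)
        + ∑ y : Fin n → Y,
        (if c.dec y = some u then permKernel W (c.enc u) y else 0) = 1 := by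
      intro u
      rw [← Finset.sum_add_distrib, ← sum_permKernel hW (c.enc u)]
      refine Finset.sum_congr rfl fun y _ => ?_
      by_cases h : c.dec y = some u <;> simp [h]
    rw [Finset.sum_congr rfl fun u _ => this u]
    simp
  linarith

end Converse

/-! ### Partitioning a bounded set into small cells -/

section Cells

/-- A bounded family in a `d`-dimensional Euclidean space is partitioned by a cubic grid of side
`1 / s` into `(2 * (⌈s * B⌉₊ + 1) + 1) ^ d` cells. -/
theorem exists_grid_partition {V : Type*} [NormedAddCommGroup V] [InnerProductSpace ℝ V]
    [FiniteDimensional ℝ V] {ι : Type*} (v : ι → V) {B s : ℝ} (hs : 0 < s)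
    (hv : ∀ u, ‖v u‖ ≤ B) :
    ∃ κ : ι → Fin (Module.finrank ℝ V) → Fin (2 * (⌈s * B⌉₊ + 1) + 1),
      ∀ u u', κ u = κ u' → ‖v u - v u'‖ ^ 2 ≤ Module.finrank ℝ V / s ^ 2 := by
  set K := ⌈s * B⌉₊ + 1 with hK
  set b := stdOrthonormalBasis ℝ V
  have hbound : ∀ u i, |s * inner ℝ (b i) (v u)| ≤ (⌈s * B⌉₊ : ℝ) := by
    intro u i
    rw [abs_mul, abs_of_pos hs]
    refine le_trans ?_ (Nat.le_ceil _)
    gcongr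
    refine (abs_real_inner_le_norm _ _).trans ?_
    rw [b.norm_eq_one, one_mul]
    exact hv u
  have hfl : ∀ u i, 0 ≤ ⌊s * inner ℝ (b i) (v u)⌋ + K ∧
      ⌊s * inner ℝ (b i) (v u)⌋ + K < 2 * K + 1 := by
    intro u i
    obtain ⟨h1, h2⟩ := abs_le.1 (hbound u i)
    have h3 : -(⌈s * B⌉₊ : ℤ) ≤ ⌊s * inner ℝ (b i) (v u)⌋ := by
      rw [Int.le_floor]
      push_cast
      exact h1
    have h4 : ⌊s * inner ℝ (b i) (v u)⌋ ≤ (⌈s * B⌉₊ : ℤ) := by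
      exact_mod_cast (Int.floor_le _).trans h2
    omega
  refine ⟨fun u i => ⟨(⌊s * inner ℝ (b i) (v u)⌋ + K).toNat, ?_⟩, fun u u' h => ?_⟩
  · have := hfl u i
    omega
  · rw [← b.sum_sq_norm_inner_right]
    have : ∀ i ∈ Finset.univ, ‖inner ℝ (b i) (v u - v u')‖ ^ 2 ≤ 1 / s ^ 2 := by
      intro i _
      have h1 := congrArg Fin.val (congrFun h i)
      simp only at h1
      have h2 : ⌊s * inner ℝ (b i) (v u)⌋ = ⌊s * inner ℝ (b i) (v u')⌋ := by
        have := hfl u i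
        have := hfl u' i
        omega
      have h3 := Int.abs_sub_lt_one_of_floor_eq_floor h2
      rw [← mul_sub, ← inner_sub_right, abs_mul, abs_of_pos hs] at h3
      rw [Real.norm_eq_abs, le_div_iff₀ (by positivity), ← mul_pow]
      exact pow_le_one₀ (by positivity) (by linarith)
    refine (Finset.sum_le_sum this).trans (le_of_eq ?_)
    simp
    ring

end Cells

/-! ### The size of codes -/

section CodeSize

variable {X Y : Type*}

theorem toLp_meanOutput_mem_polytope (W : Matrix X Y ℝ) {n : ℕ} (hn : n ≠ 0) (x : Fin n → X) :
    WithLp.toLp 2 (meanOutput W x) ∈ polytope W := by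
  have hn' : (n : ℝ) ≠ 0 := by exact_mod_cast hn
  have h : WithLp.toLp 2 (meanOutput W x) = ∑ i, (n : ℝ)⁻¹ • row W (x i) := by
    ext y
    simp [meanOutput, row, ← Finset.mul_sum, div_eq_inv_mul]
  rw [h]
  exact (convex_convexHull ℝ _).sum_mem (fun _ _ => by positivity) (by simp [hn'])
    fun i _ => subset_convexHull ℝ _ ⟨_, rfl⟩

theorem exists_code_size_bound [Fintype Y] [DecidableEq Y] [Nonempty Y] [Nonempty X] {W : Matrix X Y ℝ}
    (hW : IsChannel W) {c : ℝ} (hc0 : 0 < c) (hc : ∀ x y, c ≤ W x y) (hd : 1 ≤ dimP W) {ε : ℝ}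
    (hε : ε < 1) :
    ∃ C : ℝ, 0 < C ∧ ∀ n : ℕ, n ≠ 0 → ∀ M ∈ achievableSizes W n ε,
      (M : ℝ) ≤ C * √n ^ dimP W := by
  obtain ⟨B, hB⟩ := isBounded_iff_forall_norm_le.1 (isBounded_outputSimplex (Y := Y))
  obtain ⟨x₀⟩ := ‹Nonempty X›
  set A := affineSpan ℝ (polytope W) with hA
  have hP : ∀ p ∈ polytope W, ‖p‖ ≤ B := fun p hp => hB p (polytope_subset_refRegion hW hp).2
  have hp₀ : row W x₀ ∈ polytope W := subset_convexHull ℝ _ ⟨x₀, rfl⟩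
  have hB0 : 0 ≤ B := (norm_nonneg _).trans (hP _ hp₀)
  have hd' : (0 : ℝ) < dimP W := by exact_mod_cast hd
  set t : ℝ := √(2 * dimP W) / c ^ 2 with ht
  have ht0 : 0 < t := by positivity
  set R : ℝ := Real.exp 1 * (c / 2)⁻¹ ^ (Fintype.card Y - 1) with hR
  have hR0 : 0 < R := by positivity
  have hε' : 0 < 1 - ε := by linarith
  refine ⟨R * (2 * (t * (2 * B)) + 5) ^ dimP W / (1 - ε) ^ 2, by positivity, ?_⟩
  rintro n hn M ⟨hM, code, hcode⟩
  have hn' : (0 : ℝ) < n := by positivity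
  have hn1 : 1 ≤ √(n : ℝ) :=
    Real.one_le_sqrt.2 (by exact_mod_cast Nat.one_le_iff_ne_zero.2 hn)
  set s : ℝ := t * √n with hs
  have hs0 : 0 < s := by positivity
  have hs2 : (dimP W : ℝ) / s ^ 2 = c ^ 4 / (2 * n) := by
    rw [hs, ht, mul_pow, div_pow, Real.sq_sqrt (by positivity), Real.sq_sqrt hn'.le]
    field_simp
  let v : Fin M → A.direction := fun u =>
    ⟨WithLp.toLp 2 (meanOutput W (code.enc u)) - row W x₀,
      AffineSubspace.vsub_mem_direction
        (subset_affineSpan ℝ _ (toLp_meanOutput_mem_polytope W hn _))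
        (subset_affineSpan ℝ _ hp₀)⟩
  have hv : ∀ u, ‖v u‖ ≤ 2 * B := by
    intro u
    rw [Submodule.coe_norm]
    refine (norm_sub_le (WithLp.toLp 2 (meanOutput W (code.enc u))) (row W x₀)).trans ?_
    linarith [hP _ (toLp_meanOutput_mem_polytope W hn (code.enc u)), hP _ hp₀]
  obtain ⟨κ, hκ⟩ := exists_grid_partition v hs0 hv
  have hdist : ∀ u u', κ u = κ u' →
      ∑ y, (meanOutput W (code.enc u) y - meanOutput W (code.enc u') y) ^ 2
        ≤ c ^ 4 / (2 * n) := by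
    intro u u' h
    rw [← hs2]
    refine le_trans (le_of_eq ?_) (hκ u u' h)
    have e : ((v u - v u' : A.direction) : EuclideanSpace ℝ Y)
        = WithLp.toLp 2 (meanOutput W (code.enc u))
          - WithLp.toLp 2 (meanOutput W (code.enc u')) := by
      simp [v]
    rw [Submodule.coe_norm, e, EuclideanSpace.norm_sq_eq]
    simp
  have hq : ∀ u y, c ≤ meanOutput W (code.enc u) y := fun u y => le_meanOutput hc hn _ y
  have hq1 : ∀ u, ∑ y, meanOutput W (code.enc u) y = 1 := fun u => sum_meanOutput hW hn _
  have hmain := card_messages_le hM (fun u y => permKernel W (code.enc u) y)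
    (fun u y => ∏ i, meanOutput W (code.enc u) (y i))
    (fun u y => Finset.prod_pos fun i _ => hc0.trans_le (hq u _))
    (fun u => by
      rw [← Fintype.prod_sum fun (_ : Fin n) y => meanOutput W (code.enc u) y]
      simp [hq1])
    code.dec κ hε' hR0.le
    (fun u u' h => sum_sq_permKernel_div_le_const hW hc0 hc hn _ (hq u') (hq1 u')
      (hdist u u' h))
    (success_ge hW hM code hcode)
  refine hmain.trans ?_
  have hcard : (Fintype.card (Fin (Module.finrank ℝ A.direction) →
      Fin (2 * (⌈s * (2 * B)⌉₊ + 1) + 1)) : ℝ)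
      ≤ (2 * (t * (2 * B)) + 5) ^ dimP W * √n ^ dimP W := by
    rw [Fintype.card_fun, Fintype.card_fin, Fintype.card_fin, ← mul_pow]
    push_cast
    refine pow_le_pow_left₀ (by positivity) ?_ _
    have h1 := (Nat.ceil_lt_add_one (by positivity : 0 ≤ s * (2 * B))).le
    calc (2 * ((⌈s * (2 * B)⌉₊ : ℝ) + 1) + 1) ≤ 2 * (s * (2 * B) + 1 + 1) + 1 := by gcongr
      _ = 2 * (t * (2 * B)) * √n + 5 * 1 := by rw [hs]; ring
      _ ≤ 2 * (t * (2 * B)) * √n + 5 * √n := by gcongr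
      _ = _ := by ring
  calc R * (Fintype.card (Fin (Module.finrank ℝ A.direction) →
      Fin (2 * (⌈s * (2 * B)⌉₊ + 1) + 1)) : ℝ) / (1 - ε) ^ 2
      ≤ R * ((2 * (t * (2 * B)) + 5) ^ dimP W * √n ^ dimP W) / (1 - ε) ^ 2 := by gcongr
    _ = _ := by ring

theorem nonempty_of_one_le_dimP [Fintype Y] {W : Matrix X Y ℝ} (hd : 1 ≤ dimP W) : Nonempty X := by
  by_contra h
  rw [not_nonempty_iff] at h
  rw [dimP, polytope, Set.range_eq_empty (row W)] at hd
  simp at hd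

end CodeSize

end NoisyPerm

end

theorem mainTheorem2 {X Y : Type*} [Fintype X] [Fintype Y] [DecidableEq Y]
    (W : Matrix X Y ℝ) (hW : NoisyPerm.IsChannel W)
    (hpos : ∀ x y, 0 < W x y) (hd : 1 ≤ NoisyPerm.dimP W)
    (a : ℝ) (ha : 0 < a) (ε : ℝ) (hε : ε ∈ Set.Ioo (0 : ℝ) 1) :
    ∃ C : ℝ, ∀ᶠ n : ℕ in Filter.atTop,
      Real.logb 2 (NoisyPerm.Mstar W n ε) ≤
        NoisyPerm.dimP W * Real.logb 2 (Real.sqrt n / a)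
          + Real.logb 2 (NoisyPerm.lambdaStar W) + C := by
  have : Nonempty X := NoisyPerm.nonempty_of_one_le_dimP hd
  obtain ⟨x₀⟩ := ‹Nonempty X›
  have : Nonempty X := ⟨x₀⟩
  have : Nonempty Y := by
    by_contra h
    rw [not_nonempty_iff] at h
    simpa using hW.row_sum x₀
  obtain ⟨⟨x₁, y₁⟩, hmin⟩ := Finite.exists_min fun p : X × Y => W p.1 p.2
  obtain ⟨D, hD0, hD⟩ := NoisyPerm.exists_code_size_bound hW (hpos x₁ y₁)
    (fun x y => hmin (x, y)) hd hε.2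
  refine ⟨Real.logb 2 D + NoisyPerm.dimP W * Real.logb 2 a
    - Real.logb 2 (NoisyPerm.lambdaStar W), ?_⟩
  filter_upwards [Filter.eventually_ne_atTop 0] with n hn
  have hmem := (NoisyPerm.isGreatest_Mstar hW n hε.1.le hε.2).1
  have hM : (0 : ℝ) < NoisyPerm.Mstar W n ε := by exact_mod_cast hmem.1
  have hn0 : (0 : ℝ) < √n := Real.sqrt_pos.2 (by positivity)
  have h := Real.logb_le_logb_of_le one_lt_two hM (hD n hn _ hmem)
  rw [Real.logb_mul hD0.ne' (by positivity), Real.logb_pow] at h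
  rw [Real.logb_div hn0.ne' ha.ne']
  linarith
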